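/- Let $L$ be a finite lattice with minimum $\hat 0$ and maximum $\hat 1$. It is a geometric lattice of rank $n$ if it has a rank function $\mathrm{rk}:L\to\mathbb{N}$ with $\mathrm{rk}(\hat 0)=0$, $\mathrm{rk}(y)=\mathrm{rk}(x)+1$ whenever $y$ covers $x$, and $\mathrm{rk}(\hat 1)=n$, such that $\mathrm{rk}(x)+\mathrm{rk}(y)\ge \mathrm{rk}(x\vee y)+\mathrm{rk}(x\wedge y)$ for all $x,y\in L$, and every element of $L$ is a join of atoms. Let $\overline L=L\setminus\{\hat 0,\hat 1\}$, identified with its order complex, whose simplices are the chains of $\overline L$. The lattice $L$ is homogeneous if $\mathrm{Aut}(L)$ is transitive on the $(n-2)$-dimensional simplices of $\overline L$. For a finite simplicial complex $X$, let $X(k)$ be its set of $k$-dimensional simplices, with $X(-1)=\{\emptyset\}$ and $X(k)=\emptyset$ for $k<-1$ (the reduced setting), and let $f_k(X)=|X(k)|$. Let $C^k(X)$ be the space of functions $X(k)\to\mathbb{Z}/2$, let $d_k:C^k(X)\to C^{k+1}(X)$ be the (reduced) coboundary operator, and let $B^k(X)=d_{k-1}(C^{k-1}(X))$. For $\phi\in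 C^k(X)$ let $\|\phi\|=|\{\sigma\in X(k):\phi(\sigma)\ne 0\}|$ and $\|\phi\|_{csy}=\min_{\psi\in C^{k-1}(X)}\|\phi+d_{k-1}\psi\|$. The $k$-th Cheeger constant of $X$ is $$h^k(X)=\min_{\phi\in C^k(X)\setminus B^k(X)}\frac{\|d_k\phi\|}{\|\phi\|_{csy}}.$$ (1) If $L$ is a finite homogeneous geometric lattice of rank $n\ge 2$, then $$h^{n-3}(\overline L)\ \ge\ \frac{f_{n-2}(\overline L)}{f_{n-3}(\overline L)\,\sum_{j=1}^{n-1}j!}.$$ (2) Let $n\ge 2$, let $\mathbb{F}_q$ be a finite field with $q$ elements, and let $A_{n-1}(\mathbb{F}_q)$ be the order complex of the poset of linear subspaces of $\mathbb{F}_q^n$ other than $0$ and $\mathbb{F}_q^n$. Then $$h^{n-3}(A_{n-1}(\mathbb{F}_q))\ \ge\ \frac{f_{n-2}(A_{n-1}(\mathbb{F}_q))}{f_{n-3}(A_{n-1}(\mathbb{F}_q))\,\sum_{j=1}^{n-1}j!}\ =\ \frac{q+1}{(n-1)\sum_{j=1}^{n-1}j!}.$$ -/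

import Mathlib

namespace CheegerLattice

/-! ### Cochains of a simplicial complex with `ZMod 2` coefficients (reduced setting) -/

section Complex

variable {V : Type*} (X : AbstractSimplicialComplex V)

/-- The `k`-dimensional simplices of `X` in the reduced setting: the empty simplex is the unique
simplex of dimension `-1`, and there are none in dimension `< -1`. -/
def Face (k : ℤ) : Type _ :=
  {s : Finset V // (s = ∅ ∨ s ∈ X.faces) ∧ (s.card : ℤ) = k + 1}

/-- The number `f_k(X)` of `k`-dimensional simplices. -/
noncomputable def faceCount (k : ℤ) : ℕ := Nat.card (Face X k)

/-- The space `C^k(X; ZMod 2)` of (reduced) `k`-cochains. -/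
abbrev Cochain (k : ℤ) : Type _ := Face X k → ZMod 2

variable {X}

open Classical in
/-- The codimension one face of the simplex `τ` obtained by deleting the vertex `v`. -/
noncomputable def Face.delete {j k : ℤ} (h : j + 1 = k) (τ : Face X k) (v : τ.1) : Face X j :=
  ⟨τ.1.erase v, by
    refine ⟨?_, ?_⟩
    · rcases (τ.1.erase v.1).eq_empty_or_nonempty with he | hne
      · exact Or.inl he
      · rcases τ.2.1 with h0 | hf
        · exact absurd v.2 (by simp [h0])
        · exact Or.inr ((X.isRelLowerSet_faces hf).2 (Finset.erase_subset _ _) hne)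
    · have h1 := Finset.card_erase_add_one v.2
      have h2 := τ.2.2
      omega⟩

/-- The coboundary operator `d_j : C^j(X) → C^(j+1)(X)`; the target degree is a parameter `k`
with `j + 1 = k`. -/
noncomputable def coboundary {j k : ℤ} (h : j + 1 = k) (φ : Cochain X j) : Cochain X k :=
  fun τ => ∑ v : τ.1, φ (τ.delete h v)

/-- The norm of a cochain: the size of its support. -/
noncomputable def cochainNorm {k : ℤ} (φ : Cochain X k) : ℕ := Nat.card {σ : Face X k // φ σ ≠ 0}

/-- The cosystolic norm: the minimum of `‖φ + d_(k-1) ψ‖` over `ψ ∈ C^(k-1)(X)`. -/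
noncomputable def cosystolicNorm {k : ℤ} (φ : Cochain X k) : ℕ :=
  ⨅ ψ : Cochain X (k - 1), cochainNorm (φ + coboundary (sub_add_cancel k 1) ψ)

variable (X) in
/-- The set `B^k(X)` of `k`-coboundaries. -/
def coboundaries (k : ℤ) : Set (Cochain X k) :=
  Set.range (coboundary (X := X) (sub_add_cancel k 1))

/-- The coboundary expansion `‖d_k φ‖ / ‖φ‖_csy` (used for `φ ∉ B^k(X)`, where the denominator
is nonzero if `X` is finite). -/
noncomputable def expansion {k : ℤ} (φ : Cochain X k) : ℝ :=
  (cochainNorm (coboundary (rfl : k + 1 = k + 1) φ) : ℝ) / (cosystolicNorm φ : ℝ)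

variable (X) in
/-- The `k`-th Cheeger constant `h^k(X)` of a finite complex: the minimum of the coboundary
expansion over `C^k(X) \ B^k(X)`. -/
noncomputable def cheeger (k : ℤ) : ℝ := sInf (expansion '' (coboundaries X k)ᶜ)

end Complex

/-! ### Order complexes and geometric lattices -/

/-- The order complex of a poset: simplices are the nonempty finite chains. -/
def orderComplex (P : Type*) [PartialOrder P] : AbstractSimplicialComplex P where
  faces := {s | s.Nonempty ∧ IsChain (· ≤ ·) (s : Set P)}
  isRelLowerSet_faces := fun {_} hs =>
    ⟨hs.1, fun _ hts ht => ⟨ht, hs.2.mono (Finset.coe_subset.mpr hts)⟩⟩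
  singleton_mem := fun v => ⟨Finset.singleton_nonempty v, by simp⟩

section Lattice

variable (L : Type*) [Lattice L] [BoundedOrder L]

/-- The proper part of `L`: all elements other than the minimum and the maximum. -/
abbrev ProperPart : Type _ := {x : L // x ≠ ⊥ ∧ x ≠ ⊤}

/-- `L` is a geometric lattice with rank function `rk`. In a ranked lattice the elements of rank
one are the atoms. -/
structure IsGeometricLattice (rk : L → ℕ) : Prop where
  rk_bot : rk ⊥ = 0
  rk_covBy : ∀ x y : L, x ⋖ y → rk y = rk x + 1
  semimodular : ∀ x y : L, rk (x ⊔ y) + rk (x ⊓ y) ≤ rk x + rk y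
  join_atoms : ∀ x : L, ∃ A : Finset L, (∀ a ∈ A, IsAtom a) ∧ A.sup id = x

/-- The automorphism group of `L` (of rank `n`) is transitive on the `(n-2)`-dimensional simplices
of the order complex of the proper part. -/
def IsHomogeneous (n : ℕ) : Prop :=
  ∀ σ τ : Face (orderComplex (ProperPart L)) ((n : ℤ) - 2), ∃ g : L ≃o L,
    g '' (Subtype.val '' (σ.1 : Set (ProperPart L))) = Subtype.val '' (τ.1 : Set (ProperPart L))

end Lattice

/-- The spherical building `A_(n-1)(F)`: the order complex of the poset of nonzero proper linear
subspaces of `F^n`. -/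
abbrev building (F : Type*) [Field F] (n : ℕ) :
    AbstractSimplicialComplex (ProperPart (Submodule F (Fin n → F))) :=
  orderComplex (ProperPart (Submodule F (Fin n → F)))

end CheegerLattice

/-!
Fix an atom `a`, and choose an atom `v x ≤ x` for every `x ≠ ⊥`. A chain of `L` contracts to `a` by
replacing its elements `x` one at a time by the atoms `v x` and filling in with barycentric
subdivisions, whose vertices are joins of atoms. Fewer than `n` atoms do not join to `⊤`, so the
contraction of a chain of `n - 2` proper elements stays in the proper part; it consists of
`∑ j! (1 ≤ j ≤ n - 1)` simplices, one summand for each number of atoms that get subdivided. By the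
chain homotopy formula every `(n - 3)`-cochain `φ` is cohomologous to a cochain supported on the
simplices whose contraction meets the support of `dφ`. Averaging this over the translates of `φ`
under the automorphism group, which moves every maximal simplex uniformly over all of them, gives
`f_(n-2) ‖φ‖_csy ≤ ‖dφ‖ f_(n-3) ∑ j!`.

For the lattice of subspaces of `F^n`, every maximal chain is the flag of a basis, so the general
linear group is transitive on them. A maximal simplex has `n - 1` facets, and a simplex of
codimension one misses a single dimension, which can be filled in by the points of a projective
line.
-/

namespace CheegerLattice

/-! ### Formal sums of words modulo two -/

section Words

variable {α β : Type*}

/-- The words obtained from a word by deleting one entry. A list of words stands for its formal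
sum modulo two, so that this is the boundary of the ordered simplex `w`. -/
def wordBoundary : List α → List (List α)
  | [] => []
  | x :: w => w :: (wordBoundary w).map (x :: ·)

/-- The value of a function on words at a formal sum of words. -/
def wordEval (F : List α → ZMod 2) (c : List (List α)) : ZMod 2 := (c.map F).sum

/-- The coboundary of a function on words, dual to `wordBoundary`. -/
def wordCoboundary (F : List α → ZMod 2) (w : List α) : ZMod 2 := wordEval F (wordBoundary w)

@[simp] lemma wordEval_nil (F : List α → ZMod 2) : wordEval F [] = 0 := rfl

@[simp] lemma wordEval_cons (F : List α → ZMod 2) (w : List α) (c : List (List α)) :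
    wordEval F (w :: c) = F w + wordEval F c := by simp [wordEval]

@[simp] lemma wordEval_append (F : List α → ZMod 2) (c e : List (List α)) :
    wordEval F (c ++ e) = wordEval F c + wordEval F e := by simp [wordEval]

@[simp] lemma wordEval_map (F : List β → ZMod 2) (g : List α → List β) (c : List (List α)) :
    wordEval F (c.map g) = wordEval (fun w => F (g w)) c := by
  simp [wordEval, Function.comp_def]

@[simp] lemma wordEval_flatMap (F : List β → ZMod 2) (g : List α → List (List β))
    (c : List (List α)) :
    wordEval F (c.flatMap g) = wordEval (fun w => wordEval F (g w)) c := by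
  induction c with
  | nil => rfl
  | cons w c ih => simp [ih]

lemma wordEval_add (F G : List α → ZMod 2) (c : List (List α)) :
    wordEval (fun w => F w + G w) c = wordEval F c + wordEval G c := by
  simp [wordEval, List.sum_map_add]

@[simp] lemma wordEval_zero (c : List (List α)) : wordEval (fun _ => 0) c = 0 := by
  simp [wordEval]

lemma wordEval_congr {F G : List α → ZMod 2} {c : List (List α)} (h : ∀ w ∈ c, F w = G w) :
    wordEval F c = wordEval G c := by
  rw [wordEval, List.map_congr_left h, wordEval]

lemma wordEval_comm (F : List α → List β → ZMod 2) (c : List (List α)) (e : List (List β)) :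
    wordEval (fun u => wordEval (F u) e) c = wordEval (fun w => wordEval (F · w) c) e := by
  induction c with
  | nil => simp
  | cons u c ih => simp [ih, wordEval_add]

@[simp] lemma wordCoboundary_nil (F : List α → ZMod 2) : wordCoboundary F [] = 0 := rfl

lemma wordCoboundary_cons (F : List α → ZMod 2) (x : α) (w : List α) :
    wordCoboundary F (x :: w) = F w + wordCoboundary (fun u => F (x :: u)) w := by
  simp [wordCoboundary, wordBoundary]

@[simp] lemma wordCoboundary_singleton (F : List α → ZMod 2) (x : α) :
    wordCoboundary F [x] = F [] := by
  simp [wordCoboundary_cons]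

lemma wordCoboundary_append (F : List α → ZMod 2) (w m : List α) :
    wordCoboundary F (w ++ m) =
      wordCoboundary (fun u => F (u ++ m)) w + wordCoboundary (fun u => F (w ++ u)) m := by
  induction w generalizing F with
  | nil => simp
  | cons x w ih => simp [wordCoboundary_cons, ih, add_assoc]

lemma wordCoboundary_add (F G : List α → ZMod 2) (w : List α) :
    wordCoboundary (fun u => F u + G u) w = wordCoboundary F w + wordCoboundary G w :=
  wordEval_add F G _

lemma wordCoboundary_wordCoboundary (F : List α → ZMod 2) (w : List α) :
    wordCoboundary (wordCoboundary F) w = 0 := by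
  induction w generalizing F with
  | nil => rfl
  | cons x w ih =>
    simp only [wordCoboundary_cons, wordCoboundary_add, ih, add_zero, CharTwo.add_self_eq_zero]

lemma length_wordBoundary (w : List α) : (wordBoundary w).length = w.length := by
  induction w with
  | nil => rfl
  | cons x w ih => simp [wordBoundary, ih]

lemma length_add_one_of_mem_wordBoundary {u w : List α} (h : u ∈ wordBoundary w) :
    u.length + 1 = w.length := by
  induction w generalizing u with
  | nil => simp [wordBoundary] at h
  | cons x w ih =>
    simp only [wordBoundary, List.mem_cons, List.mem_map] at h
    rcases h with rfl | ⟨m, hm, rfl⟩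
    · rfl
    · simp [ih hm]

lemma sublist_of_mem_wordBoundary {u w : List α} (h : u ∈ wordBoundary w) : u.Sublist w := by
  induction w generalizing u with
  | nil => simp [wordBoundary] at h
  | cons x w ih =>
    simp only [wordBoundary, List.mem_cons, List.mem_map] at h
    rcases h with rfl | ⟨m, hm, rfl⟩
    · exact List.sublist_cons_self _ _
    · exact (ih hm).cons_cons x

lemma wordBoundary_induction {motive : List α → Prop}
    (step : ∀ w, (∀ u ∈ wordBoundary w, motive u) → motive w) (w : List α) : motive w :=
  step w fun u _ => wordBoundary_induction step u
termination_by w.length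
decreasing_by grind [length_add_one_of_mem_wordBoundary]

lemma wordCoboundary_eq_sum_erase [DecidableEq α] (F : List α → ZMod 2) {w : List α}
    (hw : w.Nodup) : wordCoboundary F w = ∑ y ∈ w.toFinset, F (w.erase y) := by
  induction w generalizing F with
  | nil => rfl
  | cons x w ih =>
    obtain ⟨hx, hw⟩ := List.nodup_cons.1 hw
    rw [wordCoboundary_cons, ih _ hw, List.toFinset_cons, Finset.sum_insert (by simpa using hx),
      List.erase_cons_head]
    congr 1
    refine Finset.sum_congr rfl fun y hy => ?_
    have hxy : x ≠ y := fun h => hx (h ▸ List.mem_toFinset.1 hy)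
    rw [List.erase_cons_tail (by simpa using hxy)]

lemma exists_eq_append_cons_cons_of_not_nodup [PartialOrder α] {w : List α}
    (hw : w.Pairwise (· ≤ ·)) (hn : ¬ w.Nodup) : ∃ u x m, w = u ++ x :: x :: m := by
  by_contra! hne
  refine hn (List.isChain_iff_pairwise.1 ?_ : w.Pairwise (· < ·)).nodup
  refine List.isChain_iff_forall_rel_of_append_cons_cons.2 fun x y u m h => ?_
  subst h
  have hle : x ≤ y := (List.pairwise_cons.1 (List.pairwise_append.1 hw).2.1).1 y (by simp)
  exact hle.lt_of_ne fun hxy => hne u x m (hxy ▸ rfl)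

-- Deleting either of two equal adjacent entries gives the same word.
lemma wordCoboundary_append_cons_cons {F : List α → ZMod 2} (hF : ∀ w, ¬ w.Nodup → F w = 0)
    (u : List α) (x : α) (m : List α) : wordCoboundary F (u ++ x :: x :: m) = 0 := by
  have hleft : ∀ l, F (l ++ x :: x :: m) = 0 := fun l => hF _ (by simp [List.nodup_append])
  have hright : ∀ l, F (u ++ x :: x :: l) = 0 := fun l => hF _ (by simp [List.nodup_append])
  simp only [wordCoboundary_append, wordCoboundary_cons, hleft, hright]
  simp [wordCoboundary, CharTwo.add_self_eq_zero]

end Words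

/-! ### Barycentric subdivision and the contraction -/

section Contraction

variable {L : Type*} [SemilatticeSup L] [OrderBot L]

/-- The barycentric subdivision of the ordered simplex `w`: the formal sum of the words whose
entries are the joins of the nonempty initial segments of the permutations of `w`. -/
def subdivision : List L → List (List L)
  | [] => [[]]
  | x :: w =>
    ((wordBoundary (x :: w)).attach.flatMap fun u => subdivision u.1).map
      (· ++ [Multiset.sup ↑(x :: w)])
termination_by w => w.length
decreasing_by grind [length_add_one_of_mem_wordBoundary]

@[simp] lemma subdivision_nil : subdivision ([] : List L) = [[]] := by rw [subdivision]

lemma subdivision_of_ne_nil {w : List L} (hw : w ≠ []) :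
    subdivision w = ((wordBoundary w).flatMap subdivision).map (· ++ [Multiset.sup ↑w]) := by
  obtain ⟨x, w, rfl⟩ := List.exists_cons_of_ne_nil hw
  simp [subdivision, List.flatMap_subtype]

lemma mem_subdivision_iff {w u : List L} (hw : w ≠ []) :
    u ∈ subdivision w ↔
      ∃ m ∈ wordBoundary w, ∃ t ∈ subdivision m, t ++ [Multiset.sup ↑w] = u := by
  simp only [subdivision_of_ne_nil hw, List.mem_map, List.mem_flatMap]
  grind

lemma length_subdivision (w : List L) : (subdivision w).length = w.length.factorial := by
  induction w using wordBoundary_induction with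
  | step w ih =>
    rcases eq_or_ne w [] with rfl | hw
    · simp
    have hboundary : ∀ u ∈ wordBoundary w, (subdivision u).length = (w.length - 1).factorial :=
      fun u hu => by rw [ih u hu, ← length_add_one_of_mem_wordBoundary hu, Nat.add_sub_cancel]
    rw [subdivision_of_ne_nil hw, List.length_map, List.length_flatMap,
      List.map_congr_left hboundary, List.map_const', List.sum_replicate, length_wordBoundary,
      smul_eq_mul, Nat.mul_factorial_pred (by simpa using hw)]

lemma length_of_mem_subdivision {w u : List L} (h : u ∈ subdivision w) :
    u.length = w.length := by
  induction w using wordBoundary_induction generalizing u with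
  | step w ih =>
    rcases eq_or_ne w [] with rfl | hw
    · simp_all
    obtain ⟨m, hm, t, ht, rfl⟩ := (mem_subdivision_iff hw).1 h
    rw [List.length_append, ih m hm ht, ← length_add_one_of_mem_wordBoundary hm,
      List.length_singleton]

lemma le_of_mem_subdivision {w u : List L} {b : L} (hb : ∀ x ∈ w, x ≤ b)
    (h : u ∈ subdivision w) {x : L} (hx : x ∈ u) : x ≤ b := by
  induction w using wordBoundary_induction generalizing u with
  | step w ih =>
    rcases eq_or_ne w [] with rfl | hw
    · simp_all
    obtain ⟨m, hm, t, ht, rfl⟩ := (mem_subdivision_iff hw).1 h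
    rcases List.mem_append.1 hx with hx | hx
    · exact ih m hm (fun y hy => hb y ((sublist_of_mem_wordBoundary hm).subset hy)) ht hx
    · exact List.mem_singleton.1 hx ▸ Multiset.sup_le.2 hb

lemma ne_bot_of_mem_subdivision {w u : List L} (hw : ∀ x ∈ w, x ≠ ⊥) (h : u ∈ subdivision w)
    {x : L} (hx : x ∈ u) : x ≠ ⊥ := by
  induction w using wordBoundary_induction generalizing u with
  | step w ih =>
    rcases eq_or_ne w [] with rfl | hne
    · simp_all
    obtain ⟨m, hm, t, ht, rfl⟩ := (mem_subdivision_iff hne).1 h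
    rcases List.mem_append.1 hx with hx | hx
    · exact ih m hm (fun y hy => hw y ((sublist_of_mem_wordBoundary hm).subset hy)) ht hx
    · obtain ⟨y, hy⟩ := List.exists_mem_of_ne_nil w hne
      rw [List.mem_singleton.1 hx]
      exact ne_bot_of_le_ne_bot (hw y hy) (Multiset.le_sup (Multiset.mem_coe.2 hy))

lemma pairwise_of_mem_subdivision {w u : List L} (h : u ∈ subdivision w) :
    u.Pairwise (· ≤ ·) := by
  induction w using wordBoundary_induction generalizing u with
  | step w ih =>
    rcases eq_or_ne w [] with rfl | hw
    · simp_all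
    have hle := fun {x : L} => le_of_mem_subdivision
      (fun y hy => Multiset.le_sup (Multiset.mem_coe.2 hy)) h (x := x)
    obtain ⟨m, hm, t, ht, rfl⟩ := (mem_subdivision_iff hw).1 h
    refine List.pairwise_append.2 ⟨ih m hm ht, List.pairwise_singleton _ _, fun x hx y hy => ?_⟩
    exact List.mem_singleton.1 hy ▸ hle (List.mem_append_left _ hx)

lemma wordEval_wordCoboundary_subdivision (F : List L → ZMod 2) (w : List L) :
    wordEval (wordCoboundary F) (subdivision w) =
      wordCoboundary (fun u => wordEval F (subdivision u)) w := by
  induction w using wordBoundary_induction generalizing F with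
  | step w ih =>
    rcases eq_or_ne w [] with rfl | hw
    · simp
    have hcone : wordCoboundary (fun u =>
        wordEval (wordCoboundary fun m => F (m ++ [Multiset.sup ↑w])) (subdivision u)) w = 0 :=
      (wordEval_congr fun u hu => ih u hu _).trans (wordCoboundary_wordCoboundary _ w)
    rw [wordCoboundary] at hcone
    simp only [subdivision_of_ne_nil hw, wordEval_map, wordEval_flatMap, wordCoboundary_append,
      wordCoboundary_singleton, List.append_nil, wordEval_add, hcone, zero_add]
    rfl

variable (v : L → L) (a : L)

/-- The prism homotopy from a chain `l` to the subdivision of its image under `v`, coned off with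
apex `a`. The entries of `l` are moved one at a time to the accumulator `p`, which collects their
images. -/
def prism : List L → List L → List (List L)
  | p, [] => subdivision (p ++ [a])
  | p, x :: l => (subdivision (p ++ [v x])).map (· ++ x :: l) ++ prism (p ++ [v x]) l

/-- The contraction of a chain `l` towards `a`: a chain homotopy from the identity to zero. -/
def contraction (l : List L) : List (List L) := prism v a [] l

lemma wordEval_wordCoboundary_prism (F : List L → ZMod 2) (p l : List L) :
    wordEval (wordCoboundary F) (prism v a p l) =
      wordEval (fun u => F (u ++ l)) (subdivision p) +
      wordCoboundary (fun q => wordEval F (prism v a q l)) p +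
      wordCoboundary (fun m => wordEval F (prism v a p m)) l := by
  induction l generalizing p with
  | nil =>
    simp [prism, wordEval_wordCoboundary_subdivision, wordCoboundary_append, add_comm]
  | cons x l ih =>
    have hcomm : wordEval (fun u => wordCoboundary (fun m => F (u ++ x :: m)) l)
          (subdivision (p ++ [v x])) =
        wordCoboundary (fun m => wordEval (fun u => F (u ++ x :: m)) (subdivision (p ++ [v x])))
          l :=
      wordEval_comm _ _ _
    simp only [prism, wordEval_append, wordEval_map, ih, wordCoboundary_append _ _ (x :: l),
      wordCoboundary_append _ p [v x], wordCoboundary_cons, wordCoboundary_nil, add_zero,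
      wordCoboundary_add, wordEval_add, wordEval_wordCoboundary_subdivision, List.append_nil, hcomm]
    generalize wordEval (fun u => F (u ++ l)) (subdivision (p ++ [v x])) = A
    linear_combination A * (CharTwo.two_eq_zero (R := ZMod 2))

lemma wordEval_wordCoboundary_contraction (F : List L → ZMod 2) (l : List L) :
    wordEval (wordCoboundary F) (contraction v a l) =
      F l + wordCoboundary (fun m => wordEval F (contraction v a m)) l := by
  simp [contraction, wordEval_wordCoboundary_prism]

lemma length_prism (p l : List L) :
    (prism v a p l).length =
      ∑ j ∈ Finset.Icc (p.length + 1) (p.length + l.length + 1), j.factorial := by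
  induction l generalizing p with
  | nil => simp [prism, length_subdivision]
  | cons x l ih =>
    have hle : p.length + 1 ≤ p.length + (l.length + 1) + 1 := by omega
    rw [prism, List.length_append, List.length_map, length_subdivision, ih, List.length_append,
      List.length_singleton, List.length_cons, ← Finset.add_sum_Ioc_eq_sum_Icc hle,
      ← Finset.Icc_add_one_left_eq_Ioc, ← add_assoc p.length l.length,
      add_right_comm p.length 1 l.length]

lemma length_contraction (l : List L) :
    (contraction v a l).length = ∑ j ∈ Finset.Icc 1 (l.length + 1), j.factorial := by
  simp [contraction, length_prism]

lemma length_of_mem_prism {p l u : List L} (hu : u ∈ prism v a p l) :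
    u.length = p.length + l.length + 1 := by
  induction l generalizing p with
  | nil => simpa using length_of_mem_subdivision hu
  | cons x l ih =>
    rw [prism, List.mem_append, List.mem_map] at hu
    rcases hu with ⟨t, ht, rfl⟩ | hu
    · simp only [List.length_append, length_of_mem_subdivision ht, List.length_cons,
        List.length_nil]
      omega
    · rw [ih hu, List.length_append, List.length_singleton, List.length_cons]
      omega

lemma length_of_mem_contraction {l u : List L} (hu : u ∈ contraction v a l) :
    u.length = l.length + 1 := by
  simpa using length_of_mem_prism v a hu

variable {v a}

lemma pairwise_of_mem_prism (hv : ∀ x, v x ≤ x) {p l u : List L}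
    (hpl : ∀ q ∈ p, ∀ x ∈ l, q ≤ x) (hl : l.Pairwise (· ≤ ·)) (hu : u ∈ prism v a p l) :
    u.Pairwise (· ≤ ·) := by
  induction l generalizing p with
  | nil => exact pairwise_of_mem_subdivision hu
  | cons x l ih =>
    obtain ⟨hxl, hl'⟩ := List.pairwise_cons.1 hl
    have hpx : ∀ q ∈ p ++ [v x], q ≤ x := by grind
    rw [prism, List.mem_append, List.mem_map] at hu
    rcases hu with ⟨t, ht, rfl⟩ | hu
    · refine List.pairwise_append.2 ⟨pairwise_of_mem_subdivision ht, hl, fun y hy z hz => ?_⟩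
      exact (le_of_mem_subdivision hpx ht hy).trans (by grind)
    · exact ih (fun q hq y hy => (hpx q hq).trans (hxl y hy)) hl' hu

lemma pairwise_of_mem_contraction (hv : ∀ x, v x ≤ x) {l u : List L} (hl : l.Pairwise (· ≤ ·))
    (hu : u ∈ contraction v a l) : u.Pairwise (· ≤ ·) :=
  pairwise_of_mem_prism hv (by simp) hl hu

lemma ne_bot_of_mem_prism (ha : a ≠ ⊥) {p l u : List L} (hp : ∀ q ∈ p, q ≠ ⊥)
    (hl : ∀ x ∈ l, x ≠ ⊥) (hvl : ∀ x ∈ l, v x ≠ ⊥) (hu : u ∈ prism v a p l) {y : L}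
    (hy : y ∈ u) : y ≠ ⊥ := by
  induction l generalizing p with
  | nil => exact ne_bot_of_mem_subdivision (by grind) hu hy
  | cons x l ih =>
    have hpx : ∀ q ∈ p ++ [v x], q ≠ ⊥ := by grind
    rw [prism, List.mem_append, List.mem_map] at hu
    rcases hu with ⟨t, ht, rfl⟩ | hu
    · exact (List.mem_append.1 hy).elim (ne_bot_of_mem_subdivision hpx ht) (hl y)
    · exact ih hpx (by grind) (by grind) hu

lemma ne_bot_of_mem_contraction (ha : a ≠ ⊥) {l u : List L} (hl : ∀ x ∈ l, x ≠ ⊥)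
    (hvl : ∀ x ∈ l, v x ≠ ⊥) (hu : u ∈ contraction v a l) {y : L} (hy : y ∈ u) : y ≠ ⊥ :=
  ne_bot_of_mem_prism ha (by simp) hl hvl hu hy

lemma exists_le_or_le_sup_of_mem_prism (hv : ∀ x, v x ≤ x) {p l u : List L}
    (hpl : ∀ q ∈ p, ∀ x ∈ l, q ≤ x) (hl : l.Pairwise (· ≤ ·)) (hu : u ∈ prism v a p l) {y : L}
    (hy : y ∈ u) : (∃ x ∈ l, y ≤ x) ∨ y ≤ Multiset.sup ↑(p ++ l.map v ++ [a]) := by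
  induction l generalizing p with
  | nil =>
    refine Or.inr (le_of_mem_subdivision (fun x hx => ?_) hu hy)
    exact Multiset.le_sup (by simpa using hx)
  | cons x l ih =>
    obtain ⟨hxl, hl⟩ := List.pairwise_cons.1 hl
    have hpx : ∀ q ∈ p ++ [v x], q ≤ x := by grind
    rw [prism, List.mem_append, List.mem_map] at hu
    rcases hu with ⟨t, ht, rfl⟩ | hu
    · rcases List.mem_append.1 hy with hy | hy
      · exact Or.inl ⟨x, by simp, le_of_mem_subdivision hpx ht hy⟩
      · exact Or.inl ⟨y, hy, le_rfl⟩
    · refine (ih (fun q hq z hz => (hpx q hq).trans (hxl z hz)) hl hu).imp ?_ ?_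
      · exact fun ⟨z, hz, hyz⟩ => ⟨z, List.mem_cons_of_mem x hz, hyz⟩
      · simp

lemma exists_le_or_le_sup_of_mem_contraction (hv : ∀ x, v x ≤ x) {l u : List L}
    (hl : l.Pairwise (· ≤ ·)) (hu : u ∈ contraction v a l) {y : L} (hy : y ∈ u) :
    (∃ x ∈ l, y ≤ x) ∨ y ≤ Multiset.sup ↑(l.map v ++ [a]) :=
  exists_le_or_le_sup_of_mem_prism hv (by simp) hl hu hy

end Contraction

/-! ### Cochains as functions on words -/

section Listings

variable {V L : Type*} {X : AbstractSimplicialComplex V} {j k : ℤ}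

/-- The word `l` lists without repetition the images under `f` of the vertices of `τ`. -/
def IsListing (f : V ↪ L) (l : List L) (τ : Face X k) : Prop := (l : Multiset L) = (τ.1.map f).val

variable {f : V ↪ L} {l : List L}

lemma isListing_toList (τ : Face X k) : IsListing (.refl V) τ.1.toList τ := by
  rw [IsListing, Finset.coe_toList, Finset.map_refl]

lemma IsListing.nodup {τ : Face X k} (h : IsListing f l τ) : l.Nodup :=
  Multiset.coe_nodup.1 (h ▸ (τ.1.map f).nodup)

lemma IsListing.toFinset_eq [DecidableEq L] {τ : Face X k} (h : IsListing f l τ) :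
    l.toFinset = τ.1.map f :=
  Finset.val_injective (by rw [List.toFinset_val, h.nodup.dedup, h])

lemma IsListing.mem_iff {τ : Face X k} (h : IsListing f l τ) {y : L} :
    y ∈ l ↔ ∃ p ∈ τ.1, f p = y := by
  rw [← Multiset.mem_coe, h, Finset.mem_val, Finset.mem_map]

lemma IsListing.length {τ : Face X k} (h : IsListing f l τ) : (l.length : ℤ) = k + 1 := by
  rw [← τ.2.2, ← Multiset.coe_card, h, Finset.card_val, Finset.card_map]

lemma IsListing.unique {σ τ : Face X k} (hσ : IsListing f l σ) (hτ : IsListing f l τ) : σ = τ :=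
  Subtype.ext (Finset.map_injective f (Finset.val_injective (hσ.symm.trans hτ)))

open Classical in
lemma IsListing.delete (h : j + 1 = k) {τ : Face X k} (hτ : IsListing f l τ) (v : τ.1) :
    IsListing f (l.erase (f v)) (τ.delete h v) := by
  rw [IsListing, ← Multiset.coe_erase, hτ, ← Finset.erase_val, Face.delete, Finset.map_erase]

open Classical in
variable (X k f) in
/-- The `k`-simplex listed by the word `l`, if there is one. -/
noncomputable def faceOfWord (l : List L) : Option (Face X k) :=
  if h : ∃ τ : Face X k, IsListing f l τ then some h.choose else none

lemma faceOfWord_eq_some_iff {τ : Face X k} : faceOfWord X k f l = some τ ↔ IsListing f l τ := by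
  rw [faceOfWord]
  split_ifs with h
  · rw [Option.some_inj]
    exact ⟨fun hτ => hτ ▸ h.choose_spec, h.choose_spec.unique⟩
  · exact ⟨nofun, fun hτ => absurd ⟨τ, hτ⟩ h⟩

variable (f) in
/-- The function on words which takes the value `φ τ` on the listings of `τ`, and vanishes on the
words that are not listings of simplices. -/
noncomputable def extend (φ : Cochain X k) (l : List L) : ZMod 2 :=
  (faceOfWord X k f l).elim 0 φ

lemma IsListing.extend_eq {τ : Face X k} (h : IsListing f l τ) (φ : Cochain X k) :
    extend f φ l = φ τ := by
  rw [extend, faceOfWord_eq_some_iff.2 h, Option.elim_some]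

lemma exists_isListing_of_extend_ne_zero {φ : Cochain X k} (h : extend f φ l ≠ 0) :
    ∃ τ : Face X k, IsListing f l τ := by
  simp only [← faceOfWord_eq_some_iff]
  refine Option.ne_none_iff_exists'.1 fun hnone => h ?_
  rw [extend, hnone, Option.elim_none]

lemma extend_of_not_nodup (φ : Cochain X k) (h : ¬ l.Nodup) : extend f φ l = 0 := by
  contrapose! h
  obtain ⟨τ, hτ⟩ := exists_isListing_of_extend_ne_zero h
  exact hτ.nodup

open Classical in
lemma IsListing.wordCoboundary_eq {τ : Face X k} (hτ : IsListing f l τ) (F : List L → ZMod 2) :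
    wordCoboundary F l = ∑ v : τ.1, F (l.erase (f v)) := by
  rw [wordCoboundary_eq_sum_erase F hτ.nodup, hτ.toFinset_eq, Finset.sum_map,
    Finset.sum_coe_sort τ.1 fun v => F (l.erase (f v))]

lemma IsListing.wordCoboundary_extend {τ : Face X k} (hτ : IsListing f l τ) (h : j + 1 = k)
    (φ : Cochain X j) : wordCoboundary (extend f φ) l = coboundary h φ τ := by
  classical
  rw [hτ.wordCoboundary_eq]
  exact Finset.sum_congr rfl fun v _ => (hτ.delete h v).extend_eq φ

lemma coboundary_coboundary {i : ℤ} (hij : i + 1 = j) (hjk : j + 1 = k) (φ : Cochain X i) :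
    coboundary hjk (coboundary hij φ) = 0 := by
  classical
  funext τ
  have hτ := isListing_toList τ
  rw [Pi.zero_apply, ← wordCoboundary_wordCoboundary (extend (.refl V) φ) τ.1.toList,
    hτ.wordCoboundary_eq]
  exact Finset.sum_congr rfl fun v _ => ((hτ.delete hjk v).wordCoboundary_extend hij φ).symm

end Listings

/-! ### Chains as words -/

section OrderComplex

lemma exists_list_pairwise_le_of_isChain {P : Type*} [PartialOrder P] {s : Finset P}
    (hs : IsChain (· ≤ ·) (s : Set P)) :
    ∃ l : List P, (l : Multiset P) = s.val ∧ l.Pairwise (· ≤ ·) := by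
  classical
  obtain ⟨r, _, hr⟩ := extend_partialOrder ((· ≤ ·) : P → P → Prop)
  refine ⟨s.sort r, Finset.sort_eq s r, (Finset.pairwise_sort s r).imp_of_mem ?_⟩
  intro x y hx hy hxy
  rcases hs.total ((Finset.mem_sort r).1 hx) ((Finset.mem_sort r).1 hy) with h | h
  · exact h
  · exact (antisymm hxy (hr y x h)).le

lemma Face.isChain {P : Type*} [PartialOrder P] {k : ℤ} (σ : Face (orderComplex P) k) :
    IsChain (· ≤ ·) (σ.1 : Set P) := by
  rcases σ.2.1 with h | h
  · simp [h]
  · exact h.2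

variable {L : Type*} [Lattice L] [BoundedOrder L] {j k : ℤ}

lemma IsListing.ne_bot_and_ne_top {l : List L} {σ : Face (orderComplex (ProperPart L)) k}
    (h : IsListing (.subtype _) l σ) {x : L} (hx : x ∈ l) : x ≠ ⊥ ∧ x ≠ ⊤ := by
  obtain ⟨p, -, rfl⟩ := h.mem_iff.1 hx
  exact p.2

lemma exists_isListing_pairwise_le (σ : Face (orderComplex (ProperPart L)) k) :
    ∃ l : List L, IsListing (.subtype _) l σ ∧ l.Pairwise (· ≤ ·) := by
  obtain ⟨l, hl, hle⟩ := exists_list_pairwise_le_of_isChain σ.isChain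
  refine ⟨l.map (↑), ?_, hle.map _ fun _ _ h => h⟩
  rw [IsListing, ← Multiset.map_coe, hl, Finset.map_val]
  rfl

/-- The vertices of a simplex of the order complex in increasing order. -/
noncomputable def chainWord (σ : Face (orderComplex (ProperPart L)) k) : List L :=
  (exists_isListing_pairwise_le σ).choose

lemma isListing_chainWord (σ : Face (orderComplex (ProperPart L)) k) :
    IsListing (.subtype _) (chainWord σ) σ :=
  (exists_isListing_pairwise_le σ).choose_spec.1

lemma pairwise_chainWord (σ : Face (orderComplex (ProperPart L)) k) :
    (chainWord σ).Pairwise (· ≤ ·) :=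
  (exists_isListing_pairwise_le σ).choose_spec.2

lemma chainWord_eq {σ : Face (orderComplex (ProperPart L)) k} {l : List L}
    (h : IsListing (.subtype _) l σ) (hl : l.Pairwise (· ≤ ·)) : chainWord σ = l :=
  (Multiset.coe_eq_coe.1 ((isListing_chainWord σ).trans h.symm)).eq_of_pairwise
    (fun _ _ _ _ => le_antisymm) (pairwise_chainWord σ) hl

open Classical in
lemma chainWord_delete (h : j + 1 = k) (σ : Face (orderComplex (ProperPart L)) k) (v : σ.1) :
    chainWord (σ.delete h v) = (chainWord σ).erase (v.1 : L) :=
  chainWord_eq ((isListing_chainWord σ).delete h v)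
    ((pairwise_chainWord σ).sublist List.erase_sublist)

lemma coboundary_chainWord (h : j + 1 = k) (F : List L → ZMod 2)
    (σ : Face (orderComplex (ProperPart L)) k) :
    coboundary h (fun τ => F (chainWord τ)) σ = wordCoboundary F (chainWord σ) := by
  classical
  rw [(isListing_chainWord σ).wordCoboundary_eq]
  exact Finset.sum_congr rfl fun v _ => congrArg F (chainWord_delete h σ v)

lemma exists_isListing_of_pairwise_le {l : List L} (hn : l.Nodup) (hl : l.Pairwise (· ≤ ·))
    (hk : (l.length : ℤ) = k + 1) (hproper : ∀ x ∈ l, x ≠ ⊥ ∧ x ≠ ⊤) :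
    ∃ σ : Face (orderComplex (ProperPart L)) k, IsListing (.subtype _) l σ := by
  classical
  lift l to List (ProperPart L) using hproper
  have hn' : l.Nodup := hn.of_map _
  have hchain : IsChain (· ≤ ·) (l.toFinset : Set (ProperPart L)) := by
    intro x hx y hy _
    simp only [Finset.mem_coe, List.mem_toFinset] at hx hy
    have hle : l.Pairwise (· ≤ ·) := hl.of_map Subtype.val fun _ _ h => h
    exact List.Pairwise.forall_of_forall_of_flip (R := fun x y => x ≤ y ∨ y ≤ x)
      (fun _ _ => Or.inl le_rfl) (hle.imp Or.inl) (hle.imp Or.inr) hx hy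
  refine ⟨⟨l.toFinset, ?_, ?_⟩, (?_ : (_ : Multiset L) = _)⟩
  · exact l.toFinset.eq_empty_or_nonempty.imp_right fun h => ⟨h, hchain⟩
  · rw [List.toFinset_card_of_nodup hn', ← hk, List.length_map]
  · rw [Finset.map_val, List.toFinset_val, hn'.dedup]
    rfl

lemma wordCoboundary_extend_of_pairwise_le (h : j + 1 = k)
    (φ : Cochain (orderComplex (ProperPart L)) j) {l : List L} (hl : l.Pairwise (· ≤ ·))
    (hk : (l.length : ℤ) = k + 1) (hproper : ∀ x ∈ l, x ≠ ⊥ ∧ x ≠ ⊤) :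
    wordCoboundary (extend (.subtype _) φ) l = extend (.subtype _) (coboundary h φ) l := by
  by_cases hn : l.Nodup
  · obtain ⟨σ, hσ⟩ := exists_isListing_of_pairwise_le hn hl hk hproper
    rw [hσ.wordCoboundary_extend h φ, hσ.extend_eq]
  · obtain ⟨u, x, w, rfl⟩ := exists_eq_append_cons_cons_of_not_nodup hl hn
    rw [extend_of_not_nodup _ hn]
    exact wordCoboundary_append_cons_cons (fun _ => extend_of_not_nodup φ) u x w

end OrderComplex

/-! ### Filling supports -/

section Filling

variable {V : Type*} {X : AbstractSimplicialComplex V} {j k : ℤ}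

/-- Every cochain `φ` has a cohomologous cochain whose support is contained in the set of the
simplices `σ` such that `S σ` meets the support of the coboundary of `φ`. -/
def IsFillingSupport (h : j + 1 = k) (S : Face X j → Finset (Face X k)) : Prop :=
  ∀ φ : Cochain X j, ∃ ψ : Cochain X (j - 1), ∀ σ,
    (φ + coboundary (sub_add_cancel j 1) ψ) σ ≠ 0 → ∃ τ ∈ S σ, coboundary h φ τ ≠ 0

variable {L : Type*} [Lattice L] [BoundedOrder L]

lemma exists_isAtom_le_section [IsAtomic L] :
    ∃ v : L → L, ∀ x, v x ≤ x ∧ (x ≠ ⊥ → IsAtom (v x)) := by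
  refine Classical.axiomOfChoice (r := fun x a => a ≤ x ∧ (x ≠ ⊥ → IsAtom a)) fun x => ?_
  rcases IsAtomic.eq_bot_or_exists_atom_le x with rfl | ⟨a, ha, hax⟩
  · exact ⟨⊥, le_rfl, fun h => absurd rfl h⟩
  · exact ⟨a, hax, fun _ => ha⟩

open Classical in
/-- The simplices listed by the words of the contraction of a simplex of the order complex. -/
noncomputable def contractionSupport (v : L → L) (a : L) (k : ℤ)
    (σ : Face (orderComplex (ProperPart L)) j) : Finset (Face (orderComplex (ProperPart L)) k) :=
  ((contraction v a (chainWord σ)).filterMap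
    (faceOfWord (orderComplex (ProperPart L)) k (.subtype _))).toFinset

lemma mem_contractionSupport {v : L → L} {a : L} {σ : Face (orderComplex (ProperPart L)) j}
    {τ : Face (orderComplex (ProperPart L)) k} :
    τ ∈ contractionSupport v a k σ ↔
      ∃ u ∈ contraction v a (chainWord σ), IsListing (.subtype _) u τ := by
  simp only [contractionSupport, List.mem_toFinset, List.mem_filterMap, faceOfWord_eq_some_iff]

lemma card_contractionSupport_le (v : L → L) (a : L)
    (σ : Face (orderComplex (ProperPart L)) j) {n : ℕ} (hn : (n : ℤ) = j + 2) :
    (contractionSupport v a k σ).card ≤ ∑ i ∈ Finset.Icc 1 n, i.factorial := by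
  have hlength : (chainWord σ).length + 1 = n := by
    have := (isListing_chainWord σ).length
    omega
  classical
  rw [← hlength, ← length_contraction v a]
  exact (List.toFinset_card_le _).trans (List.length_filterMap_le _ _)

lemma isFillingSupport_contractionSupport (h : j + 1 = k) {v : L → L} {a : L}
    (hv : ∀ x, v x ≤ x)
    (hproper : ∀ σ : Face (orderComplex (ProperPart L)) j,
      ∀ u ∈ contraction v a (chainWord σ), ∀ x ∈ u, x ≠ ⊥ ∧ x ≠ ⊤) :
    IsFillingSupport h (contractionSupport (L := L) v a k) := by
  intro φ
  refine ⟨fun τ => wordEval (extend (.subtype _) φ) (contraction v a (chainWord τ)),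
    fun σ hσ => ?_⟩
  rw [Pi.add_apply, coboundary_chainWord (sub_add_cancel j 1)
      (fun m => wordEval (extend (.subtype _) φ) (contraction v a m)),
    ← (isListing_chainWord σ).extend_eq φ, ← wordEval_wordCoboundary_contraction] at hσ
  obtain ⟨u, hu, hne⟩ : ∃ u ∈ contraction v a (chainWord σ),
      wordCoboundary (extend (.subtype _) φ) u ≠ 0 := by
    by_contra! hzero
    exact hσ ((wordEval_congr hzero).trans (wordEval_zero _))
  have hlength : (u.length : ℤ) = k + 1 := by
    have := (isListing_chainWord σ).length
    have := length_of_mem_contraction v a hu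
    omega
  rw [wordCoboundary_extend_of_pairwise_le h φ
    (pairwise_of_mem_contraction hv (pairwise_chainWord σ) hu) hlength (hproper σ u hu)] at hne
  obtain ⟨τ, hτ⟩ := exists_isListing_of_extend_ne_zero hne
  exact ⟨τ, mem_contractionSupport.2 ⟨u, hu, hτ⟩, hτ.extend_eq (coboundary h φ) ▸ hne⟩

lemma ne_bot_and_ne_top_of_mem_contraction {n : ℕ}
    (hjoin : ∀ A : Finset L, (∀ a ∈ A, IsAtom a) → A.card < n → A.sup id ≠ ⊤) {v : L → L}
    (hv : ∀ x, v x ≤ x) (hv_atom : ∀ x, x ≠ ⊥ → IsAtom (v x)) {a : L} (ha : IsAtom a)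
    {l u : List L} (hl : l.Pairwise (· ≤ ·)) (hproper : ∀ x ∈ l, x ≠ ⊥ ∧ x ≠ ⊤)
    (hlength : l.length + 1 < n) (hu : u ∈ contraction v a l) {x : L} (hx : x ∈ u) :
    x ≠ ⊥ ∧ x ≠ ⊤ := by
  classical
  refine ⟨ne_bot_of_mem_contraction ha.1 (fun y hy => (hproper y hy).1)
    (fun y hy => (hv_atom y (hproper y hy).1).1) hu hx, ?_⟩
  rcases exists_le_or_le_sup_of_mem_contraction hv hl hu hx with ⟨y, hy, hxy⟩ | hle
  · exact ne_top_of_le_ne_top (hproper y hy).2 hxy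
  · refine ne_top_of_le_ne_top (hjoin (l.map v ++ [a]).toFinset ?_ ?_) (hle.trans_eq ?_)
    · simp only [List.mem_toFinset]
      grind
    · refine (List.toFinset_card_le _).trans_lt ?_
      simpa using hlength
    · rw [Finset.sup_def, Multiset.map_id, List.toFinset_val, ← Multiset.coe_dedup,
        Multiset.sup_dedup]

theorem exists_isFillingSupport [IsAtomic L] [Nontrivial L] {n : ℕ}
    (hjoin : ∀ A : Finset L, (∀ a ∈ A, IsAtom a) → A.card < n → A.sup id ≠ ⊤)
    (h : j + 1 = k) (hk : k = n - 2) :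
    ∃ S : Face (orderComplex (ProperPart L)) j → Finset (Face (orderComplex (ProperPart L)) k),
      IsFillingSupport h S ∧ ∀ σ, (S σ).card ≤ ∑ i ∈ Finset.Icc 1 (n - 1), i.factorial := by
  obtain ⟨v, hv⟩ := exists_isAtom_le_section (L := L)
  refine ⟨contractionSupport v (v ⊤) k,
    isFillingSupport_contractionSupport h (fun x => (hv x).1) fun σ u hu x hx => ?_,
    fun σ => card_contractionSupport_le v _ σ ?_⟩
  · have := (isListing_chainWord σ).length
    exact ne_bot_and_ne_top_of_mem_contraction hjoin (fun x => (hv x).1) (fun x => (hv x).2)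
      ((hv ⊤).2 top_ne_bot) (pairwise_chainWord σ)
      (fun x hx => (isListing_chainWord σ).ne_bot_and_ne_top hx) (by omega) hu hx
  · have := (isListing_chainWord σ).length
    omega

end Filling

/-! ### Averaging over the automorphisms of a complex -/

section Averaging

lemma card_mul_sum_smul {G T : Type*} [Group G] [MulAction G T] [MulAction.IsPretransitive G T]
    [Fintype G] [Fintype T] (w : T → ℕ) (t : T) :
    Fintype.card T * ∑ g : G, w (g • t) = Fintype.card G * ∑ s, w s := by
  have hconst : ∀ s, ∑ g : G, w (g • s) = ∑ g : G, w (g • t) := fun s => by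
    obtain ⟨h, rfl⟩ := MulAction.exists_smul_eq G t s
    simpa [mul_smul] using Equiv.sum_comp (Equiv.mulRight h) fun g => w (g • t)
  calc Fintype.card T * ∑ g : G, w (g • t)
      = ∑ s, ∑ g : G, w (g • s) := by simp [hconst]
    _ = ∑ g : G, ∑ s, w (g • s) := Finset.sum_comm
    _ = Fintype.card G * ∑ s, w s := by
      rw [← smul_eq_mul, ← Finset.card_univ, ← Finset.sum_const]
      exact Finset.sum_congr rfl fun g _ => Equiv.sum_comp (MulAction.toPerm g) w

variable {V : Type*} {X : AbstractSimplicialComplex V} {j k : ℤ}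

instance [Finite V] : Finite (Face X k) := Subtype.finite

variable (X) in
/-- The group of simplicial automorphisms of `X`. -/
def autGroup : Subgroup (Equiv.Perm V) where
  carrier := {g | ∀ s : Finset V, s.map g.toEmbedding ∈ X.faces ↔ s ∈ X.faces}
  one_mem' s := by
    rw [show s.map (1 : Equiv.Perm V).toEmbedding = s from Finset.map_refl]
  mul_mem' {g h} hg hh s := by
    rw [← hh s, ← hg (s.map h.toEmbedding), Finset.map_map]
    rfl
  inv_mem' {g} hg s := by
    rw [← hg, Finset.map_map, show (g⁻¹).toEmbedding.trans g.toEmbedding = .refl V from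
      Function.Embedding.ext fun v => g.apply_symm_apply v, Finset.map_refl]

instance : MulAction (autGroup X) (Face X k) where
  smul g σ := ⟨σ.1.map g.1.toEmbedding, by
    rw [Finset.map_eq_empty, g.2, Finset.card_map]
    exact σ.2⟩
  one_smul σ := Subtype.ext Finset.map_refl
  mul_smul g h σ := Subtype.ext (Finset.map_map h.1.toEmbedding g.1.toEmbedding σ.1).symm

lemma coe_smul_face (g : autGroup X) (σ : Face X k) : (g • σ).1 = σ.1.map g.1.toEmbedding := rfl

lemma coboundary_comp_smul (g : autGroup X) (h : j + 1 = k) (φ : Cochain X j) (τ : Face X k) :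
    coboundary h (fun σ => φ (g • σ)) τ = coboundary h φ (g • τ) := by
  classical
  refine Fintype.sum_equiv (g.1.subtypeEquiv fun v => ?_) _ _ fun v => ?_
  · rw [coe_smul_face, Finset.mem_map_equiv, Equiv.symm_apply_apply]
  · exact congrArg φ (Subtype.ext (Finset.map_erase g.1.toEmbedding τ.1 v.1))

lemma cochainNorm_eq_card_filter [Fintype (Face X k)] (φ : Cochain X k) :
    cochainNorm φ = (Finset.univ.filter fun σ => φ σ ≠ 0).card := by
  rw [cochainNorm, Nat.card_eq_fintype_card, Fintype.card_subtype]

lemma cosystolicNorm_le (φ : Cochain X k) (ψ : Cochain X (k - 1)) :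
    cosystolicNorm φ ≤ cochainNorm (φ + coboundary (sub_add_cancel k 1) ψ) :=
  ciInf_le' _ ψ

lemma cosystolicNorm_pos [Finite V] {φ : Cochain X k} (h : φ ∉ coboundaries X k) :
    0 < cosystolicNorm φ := by
  obtain ⟨ψ, hψ⟩ : ∃ ψ, cochainNorm (φ + coboundary (sub_add_cancel k 1) ψ) = cosystolicNorm φ :=
    ciInf_mem _
  obtain ⟨σ, hσ⟩ : ∃ σ, (φ + coboundary (sub_add_cancel k 1) ψ) σ ≠ 0 := by
    by_contra! hzero
    exact h ⟨ψ, funext fun σ => (CharTwo.add_eq_zero.1 (hzero σ)).symm⟩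
  have : Nonempty {σ // (φ + coboundary (sub_add_cancel k 1) ψ) σ ≠ 0} := ⟨σ, hσ⟩
  exact hψ ▸ Nat.card_pos

lemma cosystolicNorm_le_of_smul (g : autGroup X) (φ : Cochain X k) (ψ : Cochain X (k - 1)) :
    cosystolicNorm φ ≤
      cochainNorm ((fun σ => φ (g • σ)) + coboundary (sub_add_cancel k 1) ψ) := by
  refine (cosystolicNorm_le φ fun σ => ψ (g⁻¹ • σ)).trans_eq
    (Nat.card_congr ((MulAction.toPerm g⁻¹).subtypeEquiv fun σ => ?_))
  simp [coboundary_comp_smul]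

open Classical in
lemma IsFillingSupport.cosystolicNorm_le_sum [Fintype (Face X j)] [Fintype (Face X k)]
    {h : j + 1 = k} {S : Face X j → Finset (Face X k)} (hS : IsFillingSupport h S)
    (φ : Cochain X j) (g : autGroup X) :
    cosystolicNorm φ ≤ ∑ τ with coboundary h φ τ ≠ 0,
      (Finset.univ.filter fun σ => g • τ ∈ S σ).card := by
  obtain ⟨ψ, hψ⟩ := hS fun σ => φ (g⁻¹ • σ)
  refine (cosystolicNorm_le_of_smul g⁻¹ φ ψ).trans ?_
  rw [cochainNorm_eq_card_filter]
  refine (Finset.card_le_card fun σ hσ => ?_).trans Finset.card_biUnion_le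
  obtain ⟨τ, hτ, hne⟩ := hψ σ (Finset.mem_filter.1 hσ).2
  rw [coboundary_comp_smul] at hne
  simp only [Finset.mem_biUnion, Finset.mem_filter, Finset.mem_univ, true_and]
  exact ⟨g⁻¹ • τ, hne, by rwa [smul_inv_smul]⟩

theorem IsFillingSupport.faceCount_mul_cosystolicNorm_le [Finite V]
    [MulAction.IsPretransitive (autGroup X) (Face X k)] {h : j + 1 = k}
    {S : Face X j → Finset (Face X k)} (hS : IsFillingSupport h S) {N : ℕ}
    (hcard : ∀ σ, (S σ).card ≤ N) (φ : Cochain X j) :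
    faceCount X k * cosystolicNorm φ ≤ cochainNorm (coboundary h φ) * (faceCount X j * N) := by
  classical
  have := Fintype.ofFinite (Face X j)
  have := Fintype.ofFinite (Face X k)
  have := Fintype.ofFinite (autGroup X)
  let w (τ : Face X k) : ℕ := (Finset.univ.filter fun σ => τ ∈ S σ).card
  have hw : ∑ τ, w τ ≤ faceCount X j * N := calc
    ∑ τ, w τ = ∑ σ, (S σ).card := by
      simpa [Finset.bipartiteAbove, Finset.bipartiteBelow] using
        (Finset.sum_card_bipartiteAbove_eq_sum_card_bipartiteBelow (s := Finset.univ)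
          (t := Finset.univ) fun (σ : Face X j) τ => τ ∈ S σ).symm
    _ ≤ faceCount X j * N := by
      rw [faceCount, Nat.card_eq_fintype_card]
      exact Finset.sum_le_card_nsmul _ _ _ fun σ _ => hcard σ
  refine Nat.le_of_mul_le_mul_left ?_ (Fintype.card_pos (α := autGroup X))
  calc Fintype.card (autGroup X) * (faceCount X k * cosystolicNorm φ)
      = faceCount X k * ∑ _ : autGroup X, cosystolicNorm φ := by
        rw [Finset.sum_const, Finset.card_univ, smul_eq_mul, mul_left_comm]
    _ ≤ faceCount X k * ∑ g : autGroup X, ∑ τ with coboundary h φ τ ≠ 0, w (g • τ) := by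
        gcongr
        exact hS.cosystolicNorm_le_sum φ _
    _ = ∑ τ with coboundary h φ τ ≠ 0, Fintype.card (autGroup X) * ∑ τ, w τ := by
        rw [Finset.sum_comm, Finset.mul_sum, faceCount, Nat.card_eq_fintype_card]
        exact Finset.sum_congr rfl fun τ _ => card_mul_sum_smul w τ
    _ = Fintype.card (autGroup X) * (cochainNorm (coboundary h φ) * ∑ τ, w τ) := by
        rw [Finset.sum_const, ← cochainNorm_eq_card_filter, smul_eq_mul, mul_left_comm]
    _ ≤ Fintype.card (autGroup X) * (cochainNorm (coboundary h φ) * (faceCount X j * N)) := by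
        gcongr

lemma Face.delete_injective (h : j + 1 = k) (τ : Face X k) : (τ.delete h).Injective := by
  classical
  intro u v huv
  exact Subtype.ext ((Finset.erase_inj _ u.2).1 (congrArg Subtype.val huv))

lemma Face.vertices_nonempty (τ : Face X k) (hk : 0 ≤ k) : τ.1.Nonempty :=
  Finset.card_pos.1 (by have := τ.2.2; omega)

lemma compl_coboundaries_nonempty (h : j + 1 = k) (hk : 0 ≤ k) (τ : Face X k) :
    (coboundaries X j)ᶜ.Nonempty := by
  classical
  obtain ⟨v, hv⟩ := τ.vertices_nonempty hk
  refine ⟨Pi.single (τ.delete h ⟨v, hv⟩) 1, ?_⟩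
  rintro ⟨ψ, hψ⟩
  have hzero := congrFun (coboundary_coboundary (sub_add_cancel j 1) h ψ) τ
  rw [hψ, coboundary] at hzero
  simp [Pi.single_apply, (τ.delete_injective h).eq_iff] at hzero

theorem IsFillingSupport.le_cheeger [Finite V] [MulAction.IsPretransitive (autGroup X) (Face X k)]
    (hk : 0 ≤ k) {h : j + 1 = k} {S : Face X j → Finset (Face X k)} (hS : IsFillingSupport h S)
    {N : ℕ} (hcard : ∀ σ, (S σ).card ≤ N) :
    (faceCount X k : ℝ) / (faceCount X j * N) ≤ cheeger X j := by
  have hle : ∀ r ∈ expansion '' (coboundaries X j)ᶜ,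
      (faceCount X k : ℝ) / (faceCount X j * N) ≤ r := by
    rintro _ ⟨φ, hφ, rfl⟩
    have hpos := cosystolicNorm_pos hφ
    subst h
    refine div_le_of_le_mul₀ (by positivity) (by unfold expansion; positivity) ?_
    rw [expansion, div_mul_eq_mul_div, le_div_iff₀ (by exact_mod_cast hpos)]
    exact_mod_cast hS.faceCount_mul_cosystolicNorm_le hcard φ
  rcases isEmpty_or_nonempty (Face X k) with hempty | ⟨⟨τ⟩⟩
  · exact Real.le_sInf hle (by simp [faceCount])
  · exact le_csInf ((compl_coboundaries_nonempty h hk τ).image _) hle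

end Averaging

/-! ### Homogeneous and geometric lattices -/

section Geometric

variable {L : Type*} [Lattice L] [BoundedOrder L]

/-- An order automorphism of `L` as a permutation of the proper part. -/
def properPartPerm (g : L ≃o L) : Equiv.Perm (ProperPart L) :=
  g.toEquiv.subtypeEquiv fun x => by simp

lemma properPartPerm_mem_autGroup (g : L ≃o L) :
    properPartPerm g ∈ autGroup (orderComplex (ProperPart L)) := by
  have hle : ∀ x y : ProperPart L, properPartPerm g x ≤ properPartPerm g y ↔ x ≤ y :=
    fun _ _ => g.le_iff_le
  intro s
  change (_ ∧ _) ↔ (_ ∧ _)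
  rw [Finset.map_nonempty, Finset.coe_map, IsChain, IsChain,
    Set.InjOn.pairwise_image (Function.Embedding.injective _).injOn]
  simp [Set.Pairwise, Function.onFun, hle]

lemma IsHomogeneous.isPretransitive {n : ℕ} (h : IsHomogeneous L n) :
    MulAction.IsPretransitive (autGroup (orderComplex (ProperPart L)))
      (Face (orderComplex (ProperPart L)) ((n : ℤ) - 2)) := by
  refine ⟨fun σ τ => ?_⟩
  obtain ⟨g, hg⟩ := h σ τ
  refine ⟨⟨properPartPerm g, properPartPerm_mem_autGroup g⟩, Subtype.ext (Finset.coe_injective ?_)⟩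
  rw [coe_smul_face, Finset.coe_map, ← Subtype.val_injective.image_injective.eq_iff, ← hg,
    Set.image_image, Set.image_image]
  rfl

variable {rk : L → ℕ}

lemma IsGeometricLattice.rk_atom (hL : IsGeometricLattice L rk) {a : L} (ha : IsAtom a) :
    rk a = 1 := by
  rw [hL.rk_covBy ⊥ a ha.bot_covBy, hL.rk_bot]

lemma IsGeometricLattice.rk_sup_le_card (hL : IsGeometricLattice L rk) {A : Finset L}
    (hA : ∀ a ∈ A, IsAtom a) : rk (A.sup id) ≤ A.card := by
  classical
  induction A using Finset.induction_on with
  | empty => simp [hL.rk_bot]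
  | insert a A ha ih =>
    have hatom := hL.rk_atom (hA a (Finset.mem_insert_self a A))
    have hle := ih fun b hb => hA b (Finset.mem_insert_of_mem hb)
    have hsemi := hL.semimodular a (A.sup id)
    rw [Finset.sup_insert, id, Finset.card_insert_of_notMem ha]
    omega

lemma IsGeometricLattice.sup_ne_top (hL : IsGeometricLattice L rk) {A : Finset L}
    (hA : ∀ a ∈ A, IsAtom a) (hcard : A.card < rk ⊤) : A.sup id ≠ ⊤ := by
  intro htop
  have := hL.rk_sup_le_card hA
  rw [htop] at this
  omega

end Geometric

/-! ### Counting simplices -/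

section Chains

variable {P : Type*} [PartialOrder P] {s : Finset P}

lemma exists_strictMono_range_eq {m : ℕ} (hs : IsChain (· ≤ ·) (s : Set P)) (hm : s.card = m) :
    ∃ x : Fin m → P, StrictMono x ∧ Set.range x = s := by
  obtain ⟨l, hl, hle⟩ := exists_list_pairwise_le_of_isChain hs
  obtain rfl : l.length = m := by rw [← hm, ← Multiset.coe_card, hl, Finset.card_val]
  have hlt : l.Pairwise (· < ·) :=
    (hle.and (Multiset.coe_nodup.1 (hl ▸ s.nodup))).imp fun h => h.1.lt_of_ne h.2
  refine ⟨l.get, fun i j hij => List.pairwise_iff_get.1 hlt i j hij, ?_⟩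
  ext p
  rw [Set.range_list_get, Finset.mem_coe, ← Finset.mem_val, ← hl, Multiset.mem_coe]
  rfl

variable {rk : P → ℕ}

lemma lt_of_rk_lt (hrk : StrictMono rk) {p q : P} (hpq : p ≤ q ∨ q ≤ p) (h : rk p < rk q) :
    p < q := by
  rcases hpq with hle | hle
  · exact hle.lt_of_ne fun he => h.ne (congrArg rk he)
  · exact absurd (hrk.monotone hle) h.not_ge

lemma eq_of_rk_eq (hrk : StrictMono rk) {p q : P} (hpq : p ≤ q ∨ q ≤ p) (h : rk p = rk q) :
    p = q := by
  rcases hpq with hle | hle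
  · exact hle.eq_of_not_lt fun hlt => (hrk hlt).ne h
  · exact (hle.eq_of_not_lt fun hlt => (hrk hlt).ne' h).symm

lemma exists_rk_gap (hrk : StrictMono rk) {n : ℕ} (hs : IsChain (· ≤ ·) (s : Set P))
    (hcard : s.card = n) (hle : ∀ p ∈ s, rk p ≤ n) (hzero : ∃ p ∈ s, rk p = 0)
    (hn : ∃ p ∈ s, rk p = n) :
    ∃ r, ∃ x ∈ s, ∃ y ∈ s, rk x + 1 = r ∧ rk y = r + 1 ∧
      ∀ i ≤ n, (∀ p ∈ s, rk p ≠ i) ↔ i = r := by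
  classical
  have hinj : Set.InjOn rk s := fun p hp q hq h => eq_of_rk_eq hrk (hs.total hp hq) h
  have hmissing : (Finset.range (n + 1) \ s.image rk).card = 1 := by
    rw [Finset.card_sdiff_of_subset (Finset.image_subset_iff.2 fun p hp => by grind),
      Finset.card_image_of_injOn hinj, Finset.card_range]
    omega
  obtain ⟨r, hr⟩ := Finset.card_eq_one.1 hmissing
  have hr_iff : ∀ i ≤ n, (∀ p ∈ s, rk p ≠ i) ↔ i = r := fun i hi => by
    rw [← Finset.mem_singleton, ← hr]
    grind
  have hrn : r ≤ n := by
    have := hr.ge (Finset.mem_singleton_self r)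
    grind
  have hrank : ∀ i ≤ n, i ≠ r → ∃ p ∈ s, rk p = i := fun i hi hne => by
    by_contra! h
    exact hne ((hr_iff i hi).1 h)
  have hr_ne := (hr_iff r hrn).2 rfl
  have hr0 : r ≠ 0 := fun h => by
    obtain ⟨p, hp, hp0⟩ := hzero
    exact hr_ne p hp (hp0.trans h.symm)
  have hr_ne_n : r ≠ n := fun h => by
    obtain ⟨p, hp, hpn⟩ := hn
    exact hr_ne p hp (hpn.trans h.symm)
  obtain ⟨x, hx, hxr⟩ := hrank (r - 1) (by omega) (by omega)
  obtain ⟨y, hy, hyr⟩ := hrank (r + 1) (by omega) (by omega)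
  exact ⟨r, x, hx, y, hy, by omega, hyr, hr_iff⟩

lemma exists_mem_Ioo_iff_comparable (hrk : StrictMono rk) {n : ℕ} (hle : ∀ p, rk p ≤ n)
    (hs : IsChain (· ≤ ·) (s : Set P)) (hcard : s.card = n)
    (hzero : ∃ p ∈ s, rk p = 0) (hn : ∃ p ∈ s, rk p = n) :
    ∃ x y, x < y ∧ rk y = rk x + 2 ∧
      ∀ z, z ∈ Set.Ioo x y ↔ z ∉ s ∧ ∀ p ∈ s, p ≤ z ∨ z ≤ p := by
  obtain ⟨r, x, hx, y, hy, hxr, hyr, hr⟩ :=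
    exists_rk_gap hrk hs hcard (fun p _ => hle p) hzero hn
  refine ⟨x, y, lt_of_rk_lt hrk (hs.total hx hy) (by omega), by omega, fun z => ⟨?_, ?_⟩⟩
  · rintro ⟨hxz, hzy⟩
    have hzr : rk z = r := by
      have := hrk hxz
      have := hrk hzy
      omega
    have hne := (hr (rk z) (hle z)).2 hzr
    refine ⟨fun hz => hne z hz rfl, fun p hp => ?_⟩
    rcases (hne p hp).lt_or_gt with h | h
    · refine Or.inl (le_trans ?_ hxz.le)
      by_contra hpx
      have := hrk (((hs.total hp hx).resolve_left hpx).lt_of_not_ge hpx)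
      omega
    · refine Or.inr (hzy.le.trans ?_)
      by_contra hyp
      have := hrk (((hs.total hp hy).resolve_right hyp).lt_of_not_ge hyp)
      omega
  · rintro ⟨hz, hcomp⟩
    have hzr : rk z = r := (hr (rk z) (hle z)).1 fun p hp h =>
      hz (eq_of_rk_eq hrk (hcomp p hp) h ▸ hp)
    exact ⟨lt_of_rk_lt hrk (hcomp x hx) (by omega), lt_of_rk_lt hrk (hcomp y hy).symm (by omega)⟩

end Chains

section Counting

variable {V : Type*} {X : AbstractSimplicialComplex V} {j k : ℤ}

lemma card_facets (h : j + 1 = k) (τ : Face X k) :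
    Nat.card {ρ : Face X j // ρ.1 ⊆ τ.1} = τ.1.card := by
  classical
  rw [← Nat.card_eq_finsetCard]
  refine (Nat.card_eq_of_bijective
    (fun v => (⟨τ.delete h v, Finset.erase_subset _ _⟩ : {ρ : Face X j // ρ.1 ⊆ τ.1}))
    ⟨fun u v huv => τ.delete_injective h (congrArg Subtype.val huv), fun ⟨ρ, hρ⟩ => ?_⟩).symm
  obtain ⟨v, hv⟩ := Finset.exists_eq_insert_iff.2 ⟨hρ, by have := ρ.2.2; have := τ.2.2; omega⟩
  refine ⟨⟨v, hv.2 ▸ Finset.mem_insert_self v _⟩, Subtype.ext (Subtype.ext ?_)⟩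
  exact (congrArg (·.erase v) hv.2).symm.trans (Finset.erase_insert hv.1)

lemma card_cofacets {P : Type*} [PartialOrder P] (h : j + 1 = k) (ρ : Face (orderComplex P) j) :
    Nat.card {τ : Face (orderComplex P) k // ρ.1 ⊆ τ.1} =
      Nat.card {z : P // z ∉ ρ.1 ∧ ∀ p ∈ ρ.1, p ≤ z ∨ z ≤ p} := by
  classical
  let cofacet (z : {z : P // z ∉ ρ.1 ∧ ∀ p ∈ ρ.1, p ≤ z ∨ z ≤ p}) :
      {τ : Face (orderComplex P) k // ρ.1 ⊆ τ.1} :=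
    ⟨⟨insert z.1 ρ.1, Or.inr ⟨Finset.insert_nonempty _ _, by
      rw [Finset.coe_insert]
      exact ρ.isChain.insert fun p hp _ => (z.2.2 p hp).symm⟩, by
      have := ρ.2.2
      rw [Finset.card_insert_of_notMem z.2.1]
      omega⟩, Finset.subset_insert _ _⟩
  refine (Nat.card_eq_of_bijective cofacet ⟨fun u v huv => ?_, fun ⟨τ, hτ⟩ => ?_⟩).symm
  · have hinsert : insert u.1 ρ.1 = insert v.1 ρ.1 := congrArg (fun τ => τ.1.1) huv
    exact Subtype.ext ((Finset.insert_inj u.2.1).1 hinsert)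
  · obtain ⟨z, hz, hzτ⟩ := Finset.exists_eq_insert_iff.2
      ⟨hτ, by have := ρ.2.2; have := τ.2.2; omega⟩
    refine ⟨⟨z, hz, fun p hp => ?_⟩, Subtype.ext (Subtype.ext hzτ)⟩
    exact τ.isChain.total (hτ hp) (hzτ ▸ Finset.mem_insert_self z _)

theorem faceCount_mul_eq_faceCount_mul [Finite V] (h : j + 1 = k) {m c : ℕ} (hm : (m : ℤ) = k + 1)
    (hc : ∀ ρ : Face X j, Nat.card {τ : Face X k // ρ.1 ⊆ τ.1} = c) :
    faceCount X k * m = faceCount X j * c := by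
  classical
  have := Fintype.ofFinite (Face X j)
  have := Fintype.ofFinite (Face X k)
  have hcount := Finset.card_mul_eq_card_mul (s := (Finset.univ : Finset (Face X k)))
    (t := (Finset.univ : Finset (Face X j))) (fun τ ρ => ρ.1 ⊆ τ.1) (m := m) (n := c)
    (fun τ _ => ?_) fun ρ _ => ?_
  · simpa only [faceCount, Nat.card_eq_fintype_card, Finset.card_univ] using hcount
  · rw [Finset.bipartiteAbove, ← Fintype.card_subtype, ← Nat.card_eq_fintype_card, card_facets h]
    have := τ.2.2
    omega
  · rw [Finset.bipartiteBelow, ← Fintype.card_subtype, ← Nat.card_eq_fintype_card, hc]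

end Counting

section Ranked

variable {L : Type*} [Lattice L] [BoundedOrder L] {k : ℤ}

open Classical in
/-- The chain of `L` obtained from a simplex of the order complex of the proper part by adding the
minimum and the maximum. -/
noncomputable def Face.withEnds (σ : Face (orderComplex (ProperPart L)) k) : Finset L :=
  insert ⊥ (insert ⊤ (σ.1.map (.subtype _)))

lemma Face.mem_withEnds {σ : Face (orderComplex (ProperPart L)) k} {z : L} :
    z ∈ σ.withEnds ↔ z = ⊥ ∨ z = ⊤ ∨ ∃ p ∈ σ.1, p.1 = z := by
  simp [Face.withEnds]

lemma Face.coe_mem_withEnds {σ : Face (orderComplex (ProperPart L)) k} {z : ProperPart L} :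
    z.1 ∈ σ.withEnds ↔ z ∈ σ.1 := by
  simp [Face.mem_withEnds, z.2.1, z.2.2]

lemma Face.forall_mem_withEnds_comparable {σ : Face (orderComplex (ProperPart L)) k}
    {z : ProperPart L} :
    (∀ p ∈ σ.withEnds, p ≤ z.1 ∨ z.1 ≤ p) ↔ ∀ p ∈ σ.1, p ≤ z ∨ z ≤ p := by
  refine ⟨fun h p hp => h p.1 (Face.coe_mem_withEnds.2 hp), fun h p hp => ?_⟩
  rcases Face.mem_withEnds.1 hp with rfl | rfl | ⟨q, hq, rfl⟩
  · exact Or.inl bot_le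
  · exact Or.inr le_top
  · exact h q hq

lemma Face.isChain_withEnds (σ : Face (orderComplex (ProperPart L)) k) :
    IsChain (· ≤ ·) (σ.withEnds : Set L) := by
  classical
  rw [Face.withEnds, Finset.coe_insert, Finset.coe_insert, Finset.coe_map]
  refine IsChain.insert (IsChain.insert ?_ fun _ _ _ => Or.inr le_top) fun _ _ _ => Or.inl bot_le
  exact IsChain.image_of_map_rel (· ≤ ·) (· ≤ ·) Subtype.val (fun _ _ h => h) σ.isChain

lemma Face.card_withEnds [Nontrivial L] (σ : Face (orderComplex (ProperPart L)) k) :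
    (σ.withEnds.card : ℤ) = k + 3 := by
  classical
  have := σ.2.2
  rw [Face.withEnds, Finset.card_insert_of_notMem, Finset.card_insert_of_notMem, Finset.card_map]
  · omega
  · simp
  · simp

lemma Face.image_val_eq (σ : Face (orderComplex (ProperPart L)) k) :
    Subtype.val '' (σ.1 : Set (ProperPart L)) = (σ.withEnds : Set L) \ {⊥, ⊤} := by
  ext z
  simp [Face.withEnds]

lemma Face.exists_strictMono_range_eq_withEnds [Nontrivial L] {n : ℕ}
    (σ : Face (orderComplex (ProperPart L)) ((n : ℤ) - 2)) :
    ∃ x : Fin (n + 1) → L, StrictMono x ∧ Set.range x = σ.withEnds :=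
  exists_strictMono_range_eq σ.isChain_withEnds (by have := σ.card_withEnds; omega)

lemma Face.exists_card_comparable_eq_card_Ioo [Nontrivial L] {rk : L → ℕ} (hrk : StrictMono rk)
    (hbot : rk ⊥ = 0) (ρ : Face (orderComplex (ProperPart L)) k) (htop : (rk ⊤ : ℤ) = k + 3) :
    ∃ x y : L, x < y ∧ rk y = rk x + 2 ∧
      Nat.card {z : ProperPart L // z ∉ ρ.1 ∧ ∀ p ∈ ρ.1, p ≤ z ∨ z ≤ p} =
        Nat.card (Set.Ioo x y) := by
  obtain ⟨x, y, hxy, hrank, hIoo⟩ := exists_mem_Ioo_iff_comparable hrk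
    (fun p => hrk.monotone (le_top (a := p))) ρ.isChain_withEnds
    (by have := ρ.card_withEnds; omega) ⟨⊥, Face.mem_withEnds.2 (Or.inl rfl), hbot⟩
    ⟨⊤, Face.mem_withEnds.2 (Or.inr (Or.inl rfl)), rfl⟩
  refine ⟨x, y, hxy, hrank, Nat.card_congr ((Equiv.subtypeEquivRight fun z => ?_).trans
    (Equiv.subtypeSubtypeEquivSubtype fun hz => ⟨(bot_le.trans_lt hz.1).ne',
      (hz.2.trans_le le_top).ne⟩))⟩
  rw [hIoo, Face.coe_mem_withEnds, Face.forall_mem_withEnds_comparable]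

theorem faceCount_mul_eq_faceCount_mul_of_card_Ioo [Finite L] [Nontrivial L] {rk : L → ℕ}
    (hrk : StrictMono rk) (hbot : rk ⊥ = 0) {n c : ℕ} (htop : rk ⊤ = n)
    (hc : ∀ x y : L, x < y → rk y = rk x + 2 → Nat.card (Set.Ioo x y) = c) :
    faceCount (orderComplex (ProperPart L)) ((n : ℤ) - 2) * (n - 1) =
      faceCount (orderComplex (ProperPart L)) ((n : ℤ) - 3) * c := by
  have hdim : (n : ℤ) - 3 + 1 = n - 2 := by ring
  have hpos : 0 < rk ⊤ := hbot ▸ hrk bot_lt_top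
  refine faceCount_mul_eq_faceCount_mul hdim (by omega) fun ρ => ?_
  obtain ⟨x, y, hxy, hrank, hcard⟩ :=
    ρ.exists_card_comparable_eq_card_Ioo hrk hbot (by omega)
  rw [card_cofacets hdim, hcard, hc x y hxy hrank]

end Ranked

/-! ### The lattice of subspaces -/

section Subspaces

open Module

variable {F W : Type*} [Field F] [AddCommGroup W] [Module F W]

lemma finrank_eq_of_covBy [FiniteDimensional F W] {x y : Submodule F W} (h : x ⋖ y) :
    finrank F y = finrank F x + 1 := by
  have hquot : finrank F (y ⧸ x.submoduleOf y) = 1 :=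
    isSimpleModule_iff_finrank_eq_one.1 ((covBy_iff_quot_is_simple h.le).1 h)
  rw [← Submodule.finrank_quotient_add_finrank (x.submoduleOf y), hquot,
    (Submodule.submoduleOfEquivOfLe h.le).finrank_eq, add_comm]

lemma isGeometricLattice_submodule [Finite W] :
    IsGeometricLattice (Submodule F W) fun x => finrank F x where
  rk_bot := finrank_bot F W
  rk_covBy _ _ := finrank_eq_of_covBy
  semimodular x y := (Submodule.finrank_sup_add_finrank_inf_eq x y).le
  join_atoms x := by
    have hfin : {a : Submodule F W | IsAtom a ∧ a ≤ x}.Finite := Set.toFinite _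
    refine ⟨hfin.toFinset, fun a ha => (hfin.mem_toFinset.1 ha).1, ?_⟩
    rw [Finset.sup_id_eq_sSup, hfin.coe_toFinset, sSup_atoms_le_eq]

lemma card_Ioo_bot_top_of_finrank_two [Finite F] (hW : finrank F W = 2) :
    Nat.card (Set.Ioo (⊥ : Submodule F W) ⊤) = Nat.card F + 1 := by
  have : FiniteDimensional F W := FiniteDimensional.of_finrank_pos (by omega)
  rw [← Projectivization.card_of_finrank_two F W hW]
  refine Nat.card_congr ((Equiv.subtypeEquivRight fun H => ?_).trans
    (Projectivization.equivSubmodule F W).symm)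
  have hbot : ⊥ < H ↔ 0 < finrank F H := by
    rw [bot_lt_iff_ne_bot, pos_iff_ne_zero, ne_eq, ne_eq, Submodule.finrank_eq_zero]
  have htop : H < ⊤ ↔ finrank F H < 2 := by
    rw [← hW]
    exact ⟨fun h => Submodule.finrank_lt h.ne,
      fun h => lt_top_iff_ne_top.2 fun he => h.ne (by rw [he, finrank_top])⟩
  rw [Set.mem_Ioo, hbot, htop]
  omega

variable {n : ℕ}

lemma linearIndependent_of_monotone {x : Fin (n + 1) → Submodule F W} (hx : Monotone x)
    {v : Fin n → W} (hmem : ∀ i, v i ∈ x i.succ) (hnot : ∀ i, v i ∉ x i.castSucc) :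
    LinearIndependent F v := by
  induction n with
  | zero => exact linearIndependent_empty_type
  | succ n ih =>
    have hinit := ih (hx.comp Fin.strictMono_castSucc.monotone)
      (v := Fin.init v) (fun i => hmem i.castSucc) fun i => hnot i.castSucc
    have hspan : Submodule.span F (Set.range (Fin.init v)) ≤ x (Fin.last n).castSucc := by
      rw [Submodule.span_le, Set.range_subset_iff]
      exact fun i => hx (Fin.castSucc_le_castSucc_iff.2 i.succ.le_last) (hmem i.castSucc)
    exact linearIndependent_finSucc'.2 ⟨hinit, fun h => hnot (Fin.last n) (hspan h)⟩

variable [FiniteDimensional F W]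

lemma finrank_eq_of_strictMono {x : Fin (n + 1) → Submodule F W} (hx : StrictMono x)
    (hW : finrank F W = n) (i : Fin (n + 1)) : finrank F (x i) = i := by
  let f (i : Fin (n + 1)) : Fin (n + 1) :=
    ⟨finrank F (x i), Nat.lt_succ_of_le (hW ▸ Submodule.finrank_le (x i))⟩
  have hf : StrictMono f := fun _ _ hij => Submodule.finrank_strictMono (hx hij)
  exact congrArg Fin.val (congrFun hf.eq_id i)

lemma exists_basis_flag_eq {x : Fin (n + 1) → Submodule F W} (hx : StrictMono x)
    (hW : finrank F W = n) : ∃ b : Basis (Fin n) F W, b.flag = x := by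
  choose v hmem hnot using fun i : Fin n => SetLike.exists_of_lt (hx i.castSucc_lt_succ)
  have hv := linearIndependent_of_monotone hx.monotone hmem hnot
  let b := Basis.mk hv (hv.span_eq_top_of_card_eq_finrank' (by simp [hW])).ge
  refine ⟨b, funext fun k => Submodule.eq_of_le_of_finrank_eq ?_ ?_⟩
  · refine b.flag_le_iff.2 fun i hik => hx.monotone (Fin.castSucc_lt_iff_succ_le.1 hik) ?_
    simpa only [b, Basis.mk_apply] using hmem i
  · rw [finrank_eq_of_strictMono b.flag_strictMono hW, finrank_eq_of_strictMono hx hW]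

lemma exists_orderIso_comp_eq {x y : Fin (n + 1) → Submodule F W} (hx : StrictMono x)
    (hy : StrictMono y) (hW : finrank F W = n) :
    ∃ g : Submodule F W ≃o Submodule F W, g ∘ x = y := by
  obtain ⟨b, rfl⟩ := exists_basis_flag_eq hx hW
  obtain ⟨b', rfl⟩ := exists_basis_flag_eq hy hW
  refine ⟨Submodule.orderIsoMapComap (b.equiv b' (Equiv.refl _)), funext fun i => ?_⟩
  rw [Function.comp_apply, Submodule.orderIsoMapComap_apply, Basis.flag, Submodule.map_span,
    ← Set.image_comp, Basis.flag]
  congr 2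
  ext j
  simp

lemma isHomogeneous_submodule [Nontrivial W] (hW : finrank F W = n) :
    IsHomogeneous (Submodule F W) n := by
  intro σ τ
  obtain ⟨x, hx, hσ⟩ := σ.exists_strictMono_range_eq_withEnds
  obtain ⟨y, hy, hτ⟩ := τ.exists_strictMono_range_eq_withEnds
  obtain ⟨g, rfl⟩ := exists_orderIso_comp_eq hx hy hW
  refine ⟨g, ?_⟩
  rw [σ.image_val_eq, τ.image_val_eq, Set.image_sdiff g.injective, Set.image_pair, map_bot, map_top,
    ← hσ, ← hτ, Set.range_comp]

lemma card_Ioo_of_finrank_eq_add_two [Finite F] {x y : Submodule F W} (hxy : x ≤ y)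
    (h : finrank F y = finrank F x + 2) : Nat.card (Set.Ioo x y) = Nat.card F + 1 := by
  obtain ⟨c, hc⟩ := exists_isCompl x
  obtain ⟨u, hinf, hsup⟩ : ∃ u, u ⊓ x = ⊥ ∧ u ⊔ x = y := by
    refine ⟨c ⊓ y, ?_, ?_⟩
    · rw [inf_right_comm, inf_comm c x, hc.inf_eq_bot, bot_inf_eq]
    · rw [sup_comm, ← sup_inf_assoc_of_le c hxy, hc.sup_eq_top, top_inf_eq]
  have hu : finrank F u = 2 := by
    have := Submodule.finrank_sup_add_finrank_inf_eq u x
    rw [hinf, hsup, finrank_bot] at this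
    omega
  rw [← card_Ioo_bot_top_of_finrank_two hu, ← hsup,
    ← Nat.card_congr (infIooOrderIsoIooSup u x).toEquiv, hinf]
  refine (Nat.card_congr ((u.mapIic.toEquiv.subtypeEquiv fun H => ?_).trans
    (Equiv.subtypeSubtypeEquivSubtype fun hz => hz.2.le))).symm
  have hbot : ⊥ < H ↔ ⊥ < (u.mapIic H).1 := by
    rw [← u.mapIic.lt_iff_lt, map_bot]
    rfl
  have htop : H < ⊤ ↔ (u.mapIic H).1 < u := by
    rw [← u.mapIic.lt_iff_lt, map_top]
    rfl
  exact and_congr hbot htop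

end Subspaces

section Building

variable (F : Type*) [Field F] {n : ℕ}

lemma nonempty_face_building (hn : 2 ≤ n) : Nonempty (Face (building F n) ((n : ℤ) - 3)) := by
  classical
  let b := Pi.basisFun F (Fin n)
  let f (i : Fin (n - 2)) : ProperPart (Submodule F (Fin n → F)) :=
    ⟨b.flag ⟨i + 1, by omega⟩, by
      rw [← bot_lt_iff_ne_bot, ← lt_top_iff_ne_top, ← b.flag_zero, ← b.flag_last,
        b.flag_strictMono.lt_iff_lt, b.flag_strictMono.lt_iff_lt, Fin.lt_def, Fin.lt_def]
      simp only [Fin.val_zero, Fin.val_last]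
      omega⟩
  have hf : StrictMono f := fun _ _ hij =>
    b.flag_strictMono (Fin.mk_lt_mk.2 (Nat.succ_lt_succ hij))
  refine ⟨⟨Finset.univ.image f, ?_, ?_⟩⟩
  · refine (Finset.univ.image f).eq_empty_or_nonempty.imp_right fun hne => ⟨hne, ?_⟩
    rw [Finset.coe_image, Finset.coe_univ, Set.image_univ]
    exact hf.monotone.isChain_range
  · rw [Finset.card_image_of_injective _ hf.injective, Finset.card_univ, Fintype.card_fin]
    omega

lemma faceCount_building [Finite F] (hn : 2 ≤ n) :
    faceCount (building F n) ((n : ℤ) - 2) * (n - 1) =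
      faceCount (building F n) ((n : ℤ) - 3) * (Nat.card F + 1) := by
  have : Nontrivial (Fin n → F) := Module.nontrivial_of_finrank_pos (R := F) (by simp; omega)
  exact faceCount_mul_eq_faceCount_mul_of_card_Ioo Submodule.finrank_strictMono (finrank_bot F _)
    (by simp) fun _ _ hxy => card_Ioo_of_finrank_eq_add_two hxy.le

lemma faceCount_building_div [Finite F] (hn : 2 ≤ n) :
    (faceCount (building F n) ((n : ℤ) - 2) : ℝ) / faceCount (building F n) ((n : ℤ) - 3) =
      ((Nat.card F : ℝ) + 1) / ((n : ℝ) - 1) := by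
  have hpos : 0 < faceCount (building F n) ((n : ℤ) - 3) :=
    Nat.card_pos_iff.2 ⟨nonempty_face_building F hn, inferInstance⟩
  have hcount : (faceCount (building F n) ((n : ℤ) - 2) : ℝ) * ((n : ℝ) - 1) =
      faceCount (building F n) ((n : ℤ) - 3) * ((Nat.card F : ℝ) + 1) := by
    rw [← Nat.cast_pred (by omega : 0 < n)]
    exact_mod_cast faceCount_building F hn
  have hn' : (1 : ℝ) < n := by exact_mod_cast hn
  rw [div_eq_div_iff (by positivity) (by linarith), hcount, mul_comm]

end Building

end CheegerLattice

open CheegerLattice in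
theorem theoremt_general {L : Type*} [Lattice L] [BoundedOrder L] [Finite L] {n : ℕ} (hn : 2 ≤ n)
    (hjoin : ∀ A : Finset L, (∀ a ∈ A, IsAtom a) → A.card < n → A.sup id ≠ ⊤)
    [MulAction.IsPretransitive (autGroup (orderComplex (ProperPart L)))
      (Face (orderComplex (ProperPart L)) ((n : ℤ) - 2))] :
    (faceCount (orderComplex (ProperPart L)) ((n : ℤ) - 2) : ℝ) /
        ((faceCount (orderComplex (ProperPart L)) ((n : ℤ) - 3) : ℝ) *
          ∑ j ∈ Finset.Icc 1 (n - 1), (Nat.factorial j : ℝ))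
      ≤ cheeger (orderComplex (ProperPart L)) ((n : ℤ) - 3) := by
  have : Nontrivial L := ⟨⊥, ⊤, hjoin ∅ (by simp) (by rw [Finset.card_empty]; omega)⟩
  obtain ⟨S, hS, hcard⟩ := exists_isFillingSupport hjoin (by ring : (n : ℤ) - 3 + 1 = n - 2) rfl
  exact_mod_cast hS.le_cheeger (by omega) hcard

open CheegerLattice in
theorem theoremt :
    (∀ (L : Type*) [Lattice L] [BoundedOrder L] [Finite L] (rk : L → ℕ) (n : ℕ),
      2 ≤ n → IsGeometricLattice L rk → rk ⊤ = n → IsHomogeneous L n →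
      (faceCount (orderComplex (ProperPart L)) ((n : ℤ) - 2) : ℝ) /
          ((faceCount (orderComplex (ProperPart L)) ((n : ℤ) - 3) : ℝ) *
            ∑ j ∈ Finset.Icc 1 (n - 1), (Nat.factorial j : ℝ))
        ≤ cheeger (orderComplex (ProperPart L)) ((n : ℤ) - 3)) ∧
    (∀ (F : Type*) [Field F] [Finite F] (n : ℕ), 2 ≤ n →
      (faceCount (building F n) ((n : ℤ) - 2) : ℝ) /
          ((faceCount (building F n) ((n : ℤ) - 3) : ℝ) *
            ∑ j ∈ Finset.Icc 1 (n - 1), (Nat.factorial j : ℝ))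
        ≤ cheeger (building F n) ((n : ℤ) - 3) ∧
      (faceCount (building F n) ((n : ℤ) - 2) : ℝ) /
          ((faceCount (building F n) ((n : ℤ) - 3) : ℝ) *
            ∑ j ∈ Finset.Icc 1 (n - 1), (Nat.factorial j : ℝ))
        = ((Nat.card F : ℝ) + 1) /
          (((n : ℝ) - 1) * ∑ j ∈ Finset.Icc 1 (n - 1), (Nat.factorial j : ℝ))) := by
  refine ⟨fun L _ _ _ rk n hn hL hrk hhom => ?_, fun F _ _ n hn => ⟨?_, ?_⟩⟩
  · have := hhom.isPretransitive
    exact theoremt_general hn fun A hA hcard => hL.sup_ne_top hA (hrk ▸ hcard)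
  · have hdim : Module.finrank F (Fin n → F) = n := by simp
    have : Nontrivial (Fin n → F) := Module.nontrivial_of_finrank_pos (R := F) (by omega)
    have := (isHomogeneous_submodule hdim).isPretransitive
    exact theoremt_general hn fun A hA hcard =>
      isGeometricLattice_submodule.sup_ne_top hA (by rwa [finrank_top, hdim])
  · rw [← div_div, ← div_div, faceCount_building_div F hn]
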